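/- A discrete integration query $(F,W)$ consists of a Boolean formula $F$ over variables $x_1,\dots,x_n$ and literal weights $W(x_i)=p_i/q_i$, $W(\neg x_i)=1-p_i/q_i$ with integers $0<p_i<q_i$. The weight of an assignment is the product of the weights of its literals, and $W(F)$ is the sum of the weights of the satisfying assignments of $F$. For $0<k<2^m$ with $m$-bit binary representation $c_1\cdots c_m$ ($c_1$ most significant) whose last $1$ is at position $t$, the chain formula is $\varphi_{k,m}(a_1,\dots,a_m)=a_1\,C_1\,(a_2\,C_2\,(\cdots(a_{t-1}\,C_{t-1}\,a_t)\cdots))$, with $C_j=\vee$ if $c_j=1$ and $C_j=\wedge$ if $c_j=0$; and $\varphi_{2^m,m}$ is the constant true. Let $m_i=\lceil\max(\log_2 p_i,\log_2(q_i-p_i))\rceil$, let $\hat F=F\wedge\bigwedge_i\big((x_i\to\varphi_{p_i,m_i})\wedge(\neg x_i\to\varphi_{q_i-p_i,m_i})\big)$, a formula over $n+\sum_i m_i$ variables in which both chain formulas for $x_i$ use the same $m_i$ fresh variables, and let $C_W=\prod_i q_i$. For $\varepsilon>0$ and $\delta\in(0,1]$, a random value $v$ is an $(\varepsilon,\delta)$-estimate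 of $w$ if $\Pr\big[\frac{w}{1+\varepsilon}\le v\le(1+\varepsilon)w\big]\ge 1-\delta$. An approximate model counter is a randomized procedure $\mathcal B$ that on every formula and all such $\varepsilon,\delta$ returns an $(\varepsilon,\delta)$-estimate of the number of satisfying assignments. Algorithm $\mathcal A$ constructs $\hat F$ and $C_W$, runs an approximate model counter $\mathcal B$ on $(\hat F,\varepsilon,\delta)$, and returns the result divided by $C_W$. Theorem. (1) For every approximate model counter $\mathcal B$, every query $(F,W)$ and all $\varepsilon>0$, $\delta\in(0,1]$, the value returned by $\mathcal A$ is an $(\varepsilon,\delta)$-estimate of $W(F)$. (2) Let $\mathcal B$ be the following hashing-based counter (of the ApproxMC type), which uses an oracle for Boolean satisfiability. Put $K=\lceil128(1+1/\varepsilon)^2\rceil+1$. The satisfying assignments of a formula are counted up to $K$, by asking for $k=1,2,\dots$ whether there are at least $k$ of them (one satisfiability query each); if the formula has fewer than $K$, that number is returned. Otherwise, for a formula with $N$ variables, repeat $\max(1,\lceil\log_2(1/\delta)\rceil)$ times independently: draw $N$ uniformly random XOR constraints, find by binary search a number $m\le N$ such that the formula together with the first $m$ constraints has fewer than $K$ satisfying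 assignments but together with the first $m-1$ has not ($m=N$ if there is no such number), count its satisfying assignments up to $K$, and take $2^m$ times this count as estimate; return the median of the estimates. Then $\mathcal B$ is an approximate model counter, and there is an absolute constant $C$ such that with this $\mathcal B$, for every query and all $\varepsilon>0$, $\delta\in(0,1]$, every run of $\mathcal A$ makes at most $$C\cdot\frac{\max\big(1,\log_2(n+\sum_i m_i)\big)\cdot\max\big(1,\log_2(1/\delta)\big)}{\min(1,\varepsilon^2)}$$ calls to the NP oracle. In particular, the number of calls is $O\big(\log(n+\sum_i m_i)\log(1/\delta)/\varepsilon^2\big)$ for $n+\sum_i m_i\ge2$, $\delta\le1/2$, $\varepsilon\le1$. -/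

import Mathlib

/-! ### Boolean formulas -/

/-- Boolean formulas over a set `V` of variables. -/
inductive BForm (V : Type) : Type
  | tru : BForm V
  | var : V → BForm V
  | neg : BForm V → BForm V
  | conj : BForm V → BForm V → BForm V
  | disj : BForm V → BForm V → BForm V
  | imp : BForm V → BForm V → BForm V
  | xor : BForm V → BForm V → BForm V

namespace BForm

/-- Truth value of a formula under an assignment. -/
def eval {V : Type} (σ : V → Bool) : BForm V → Bool
  | tru => true
  | var v => σ v
  | neg F => !F.eval σ
  | conj F G => F.eval σ && G.eval σ
  | disj F G => F.eval σ || G.eval σ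
  | imp F G => !F.eval σ || G.eval σ
  | xor F G => Bool.xor (F.eval σ) (G.eval σ)

/-- Renaming of variables. -/
def relabel {V V' : Type} (f : V → V') : BForm V → BForm V'
  | tru => tru
  | var v => var (f v)
  | neg F => neg (F.relabel f)
  | conj F G => conj (F.relabel f) (G.relabel f)
  | disj F G => disj (F.relabel f) (G.relabel f)
  | imp F G => imp (F.relabel f) (G.relabel f)
  | xor F G => xor (F.relabel f) (G.relabel f)

/-- Conjunction of a list of formulas. -/
def bigConj {V : Type} (l : List (BForm V)) : BForm V := l.foldr conj tru

/-- Disjunction of a list of formulas. -/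
def bigDisj {V : Type} (l : List (BForm V)) : BForm V := l.foldr disj (neg tru)

/-- The set of witnesses (satisfying assignments) of a formula over the variables `x_0, …, x_{N-1}`.
Every one of the `N` variables is assigned, whether or not it occurs in the formula. -/
def witnesses {N : ℕ} (F : BForm (Fin N)) : Finset (Fin N → Bool) :=
  Finset.univ.filter fun σ => F.eval σ = true

end BForm

/-! ### The reduction from discrete integration to model counting -/

/-- A log-linear discrete integration query `(F, W)` on `n` variables: a formula and rational
literal weights `W(x_i) = p_i / q_i` with `0 < p_i / q_i < 1` and `W(¬ x_i) = 1 - W(x_i)`. -/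
structure DIQuery (n : ℕ) where
  /-- the formula -/
  F : BForm (Fin n)
  /-- numerators of the weights of the positive literals -/
  p : Fin n → ℕ
  /-- denominators of the weights -/
  q : Fin n → ℕ
  p_pos : ∀ i, 0 < p i
  p_lt_q : ∀ i, p i < q i

/-- For the pairs `(c_1, a_1), …, (c_t, a_t)` the formula `a_1 C_1 (a_2 C_2 (⋯ (a_{t-1} C_{t-1} a_t)))`,
where the connector `C_j` is `∨` if `c_j = 1` and `∧` if `c_j = 0`. -/
def chainList {V : Type} : List (Bool × V) → BForm V
  | [] => BForm.tru
  | [(_, a)] => BForm.var a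
  | (c, a) :: x :: l =>
    if c then BForm.disj (BForm.var a) (chainList (x :: l))
    else BForm.conj (BForm.var a) (chainList (x :: l))

/-- The chain formula `φ_{k,m}(a_1, …, a_m)` for `0 < k ≤ 2 ^ m`. If `k < 2 ^ m`, it is built from
the `m`-bit binary representation `c_1 ⋯ c_m` of `k` (most significant bit first), cut off after the
last bit that is `1`. For `k = 2 ^ m` it is the constant true. -/
def chainFormula {V : Type} (k m : ℕ) (a : Fin m → V) : BForm V :=
  if k = 2 ^ m then BForm.tru
  else chainList
    ((List.ofFn fun j : Fin m => (k.testBit (m - 1 - (j : ℕ)), a j)).rdropWhile fun x => !x.1)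

namespace DIQuery

variable {n : ℕ}

/-- The weight of a literal of `x_i`: `W(x_i)` for `true`, `W(¬ x_i)` for `false`. -/
noncomputable def litWeight (Q : DIQuery n) (i : Fin n) : Bool → ℝ
  | true => (Q.p i : ℝ) / Q.q i
  | false => 1 - (Q.p i : ℝ) / Q.q i

/-- The weight of an assignment: the product of the weights of its literals. -/
noncomputable def assignWeight (Q : DIQuery n) (σ : Fin n → Bool) : ℝ :=
  ∏ i, Q.litWeight i (σ i)

/-- The weight `W(F)`. -/
noncomputable def weight (Q : DIQuery n) : ℝ := ∑ σ ∈ Q.F.witnesses, Q.assignWeight σ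

/-- `m_i = ⌈max (log₂ p_i, log₂ (q_i - p_i))⌉`. -/
noncomputable def bits (Q : DIQuery n) (i : Fin n) : ℕ :=
  ⌈max (Real.logb 2 (Q.p i : ℝ)) (Real.logb 2 ((Q.q i : ℝ) - (Q.p i : ℝ)))⌉₊

/-- The number `n + ∑ i, m_i` of variables after the reduction. -/
noncomputable def numVars (Q : DIQuery n) : ℕ := n + ∑ i, Q.bits i

/-- The position of the original variable `x_i` among the variables of the reduced formula. -/
noncomputable def oldVar (Q : DIQuery n) (i : Fin n) : Fin Q.numVars :=
  finSumFinEquiv (Sum.inl i)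

/-- The position of the fresh variable `x_{i,j}` among the variables of the reduced formula. -/
noncomputable def freshVar (Q : DIQuery n) (i : Fin n) (j : Fin (Q.bits i)) : Fin Q.numVars :=
  finSumFinEquiv (Sum.inr (finSigmaFinEquiv ⟨i, j⟩))

/-- `(x_i → φ_{p_i, m_i}) ∧ (¬ x_i → φ_{q_i - p_i, m_i})`, both chain formulas over the same fresh
variables `x_{i,1}, …, x_{i,m_i}`. -/
noncomputable def gadget (Q : DIQuery n) (i : Fin n) : BForm (Fin Q.numVars) :=
  BForm.conj
    (BForm.imp (BForm.var (Q.oldVar i)) (chainFormula (Q.p i) (Q.bits i) (Q.freshVar i)))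
    (BForm.imp (BForm.neg (BForm.var (Q.oldVar i)))
      (chainFormula (Q.q i - Q.p i) (Q.bits i) (Q.freshVar i)))

/-- The reduced formula `F̂ = F ∧ Ω`. -/
noncomputable def hatF (Q : DIQuery n) : BForm (Fin Q.numVars) :=
  BForm.conj (Q.F.relabel Q.oldVar) (BForm.bigConj (List.ofFn Q.gadget))

/-- The normalization `C_W = ∏ i, q_i`. -/
noncomputable def normC (Q : DIQuery n) : ℝ := ∏ i, (Q.q i : ℝ)

end DIQuery

/-! ### Randomized algorithms with an NP oracle -/

/-- A deterministic computation with a decision oracle for the satisfiability of Boolean formulas: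
it returns a value, or asks whether a formula is satisfiable and goes on with the answer. -/
inductive OracleProg (α : Type) : Type
  | ret : α → OracleProg α
  | ask : BForm ℕ → (Bool → OracleProg α) → OracleProg α

/-- The NP oracle: Boolean satisfiability. -/
noncomputable def satOracle (G : BForm ℕ) : Bool :=
  @decide (∃ σ : ℕ → Bool, G.eval σ = true) (Classical.propDecidable _)

namespace OracleProg

/-- Run one computation, then a second one that depends on the value of the first. -/
def bind {α β : Type} : OracleProg α → (α → OracleProg β) → OracleProg β
  | ret a, f => f a
  | ask G k, f => ask G fun b => (k b).bind f

/-- The returned value. -/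
noncomputable def value {α : Type} : OracleProg α → α
  | ret a => a
  | ask G k => (k (satOracle G)).value

/-- The number of calls to the oracle in the run. -/
noncomputable def calls {α : Type} : OracleProg α → ℕ
  | ret _ => 0
  | ask G k => (k (satOracle G)).calls + 1

/-- Run the computations of a list one after the other. -/
def runAll {α : Type} : List (OracleProg α) → OracleProg (List α)
  | [] => ret []
  | P :: l => P.bind fun a => (runAll l).bind fun as => ret (a :: as)

end OracleProg

/-- A randomized computation with an NP oracle: a random seed, and a deterministic oracle
computation for every value of the seed. -/
structure RandAlg (α : Type) where
  /-- the values of the seed -/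
  Seed : Type
  /-- the distribution of the seed -/
  law : PMF Seed
  /-- the computation for a given seed -/
  prog : Seed → OracleProg α

/-- The value `v` returned by `R` is an `(ε, δ)` estimate of `w`:
`Pr[w / (1 + ε) ≤ v ≤ (1 + ε) * w] ≥ 1 - δ`. -/
def IsEstimate (R : RandAlg ℝ) (ε δ w : ℝ) : Prop :=
  ENNReal.ofReal (1 - δ) ≤ R.law.toOuterMeasure
    {s | w / (1 + ε) ≤ (R.prog s).value ∧ (R.prog s).value ≤ (1 + ε) * w}

/-- A procedure that gets a formula, a tolerance `ε` and a `δ`, and returns a number. -/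
abbrev ModelCounter : Type 1 := (N : ℕ) → BForm (Fin N) → ℝ → ℝ → RandAlg ℝ

/-- `B` is an approximate model counter: on every formula and for all `ε > 0` and `δ ∈ (0, 1]` it
returns an `(ε, δ)` estimate of the number of witnesses. -/
def IsApproxModelCounter (B : ModelCounter) : Prop :=
  ∀ (N : ℕ) (F : BForm (Fin N)) (ε δ : ℝ), 0 < ε → 0 < δ → δ ≤ 1 →
    IsEstimate (B N F ε δ) ε δ (F.witnesses.card : ℝ)

/-- The algorithm `𝒜` on top of the model counter `B`: construct `F̂` and `C_W`, run `B` on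
`(F̂, ε, δ)`, and divide the result by `C_W`. -/
noncomputable def algA (B : ModelCounter) {n : ℕ} (Q : DIQuery n) (ε δ : ℝ) : RandAlg ℝ where
  Seed := (B Q.numVars Q.hatF ε δ).Seed
  law := (B Q.numVars Q.hatF ε δ).law
  prog := fun s =>
    ((B Q.numVars Q.hatF ε δ).prog s).bind fun v => OracleProg.ret (v / Q.normC)

/-! ### A hashing-based approximate model counter

An approximate model counter of the ApproxMC type: random XOR constraints split the witnesses into
cells, a binary search finds the number of constraints for which the cell becomes small, the size of
that cell is counted by oracle calls, and the median over independent repetitions is returned. -/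

/-- A formula that is satisfiable iff `G` has at least `k` witnesses: `k` copies of `G` on disjoint
variables, with the requirement that the copies of the assignment are pairwise different. -/
def atLeast {N : ℕ} (G : BForm (Fin N)) (k : ℕ) : BForm ℕ :=
  BForm.conj
    (BForm.bigConj (List.ofFn fun c : Fin k => G.relabel fun v : Fin N => Nat.pair (c : ℕ) (v : ℕ)))
    (BForm.bigConj (List.ofFn fun c : Fin k => BForm.bigConj (List.ofFn fun d : Fin (c : ℕ) =>
      BForm.bigDisj (List.ofFn fun v : Fin N =>
        BForm.xor (BForm.var (Nat.pair (c : ℕ) (v : ℕ)))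
          (BForm.var (Nat.pair (d : ℕ) (v : ℕ)))))))

/-- Having found `c` witnesses of `G`, look for at most `r` further ones, one oracle call each. -/
def countFrom {N : ℕ} (G : BForm (Fin N)) : ℕ → ℕ → OracleProg ℕ
  | 0, c => OracleProg.ret c
  | r + 1, c => OracleProg.ask (atLeast G (c + 1)) fun b =>
      if b then countFrom G r (c + 1) else OracleProg.ret c

/-- Count the witnesses of `G` up to `K`. -/
def boundedCount {N : ℕ} (G : BForm (Fin N)) (K : ℕ) : OracleProg ℕ := countFrom G K 0

/-- The constraint `⨁ v, a_v x_v = b`, for `r = (a, b)`. -/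
def xorConstraint {N : ℕ} (r : (Fin N → Bool) × Bool) : BForm (Fin N) :=
  ((List.finRange N).filter r.1).foldr (fun v G => BForm.xor (BForm.var v) G)
    (if r.2 then BForm.neg BForm.tru else BForm.tru)

/-- `F` together with the first `m` of the XOR constraints `h`. -/
def cellFormula {N : ℕ} (F : BForm (Fin N)) (h : Fin N → (Fin N → Bool) × Bool) (m : ℕ) :
    BForm (Fin N) :=
  BForm.conj F (BForm.bigConj (((List.ofFn h).take m).map xorConstraint))

/-- Binary search in `(lo, hi]` for the first `m` such that `G m` has fewer than `K` witnesses. -/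
def cellSearch {N : ℕ} (G : ℕ → BForm (Fin N)) (K lo hi : ℕ) : OracleProg ℕ :=
  if hi ≤ lo + 1 then OracleProg.ret hi
  else (boundedCount (G ((lo + hi) / 2)) K).bind fun c =>
    if c < K then cellSearch G K lo ((lo + hi) / 2) else cellSearch G K ((lo + hi) / 2) hi
termination_by hi - lo
decreasing_by all_goals omega

/-- One estimate of the number of witnesses: the number of cells times the size of a small cell. -/
def cellEstimate {N : ℕ} (F : BForm (Fin N)) (K : ℕ) (h : Fin N → (Fin N → Bool) × Bool) :
    OracleProg ℕ :=
  (cellSearch (cellFormula F h) K 0 N).bind fun m =>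
    (boundedCount (cellFormula F h m) K).bind fun c => OracleProg.ret (2 ^ m * c)

/-- The median of a list of numbers. -/
def listMedian (l : List ℕ) : ℕ := (l.insertionSort (· ≤ ·)).getD (l.length / 2) 0

/-- Cells with fewer than this number of witnesses count as small. -/
noncomputable def cellThreshold (ε : ℝ) : ℕ := ⌈128 * (1 + 1 / ε) ^ 2⌉₊ + 1

/-- The number of repetitions. -/
noncomputable def repetitions (δ : ℝ) : ℕ := max 1 ⌈Real.logb 2 (1 / δ)⌉₊

/-- The hashing-based approximate model counter. Its seed consists of independent fair bits: for every
repetition the coefficients and the right-hand sides of `N` XOR constraints. Formulas with few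
witnesses are counted exactly. -/
noncomputable def hashCounter : ModelCounter := fun N F ε δ =>
  { Seed := Fin (repetitions δ) → Fin N → (Fin N → Bool) × Bool
    law := PMF.uniformOfFintype _
    prog := fun s =>
      (boundedCount F (cellThreshold ε)).bind fun c =>
        if c < cellThreshold ε then OracleProg.ret (c : ℝ)
        else
          (OracleProg.runAll
            (List.ofFn fun i => cellEstimate F (cellThreshold ε) (s i))).bind fun l =>
              OracleProg.ret (listMedian l : ℝ) }

/-! ### Semantics of formulas -/

namespace BForm

/-! The reduction is exact. A chain formula for `k` over `m` variables has exactly `k` models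
(`card_chainFormula`), so an assignment `σ` of the original variables extends to `F̂` in as many
ways as the product of its integer literal weights `p_i` or `q_i - p_i`, the fresh variables of
different `i` being independent. Hence the model count of `F̂` is `W(F) * C_W` (`weight_mul_normC`),
and dividing by `C_W` carries a multiplicative estimate of one to the other.

For the hashing counter, a random XOR constraint holds at a given point with probability 1/2 and at
two distinct points with probability 1/4. Pairwise independence makes the variance of a cell size at
most its mean `μ_m = |witnesses| / 2 ^ m`, so Chebyshev applies (`card_deviation_le`). Fix a level
`M` with `μ_M` between 0.3 and 0.6 times the threshold `K`. Outside an event of probability at most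
1/16, every cell up to level `M` is within relative error `ε / (1 + ε)` of its mean and the cell at
`M` is small (`card_not_goodSeed_le`). The search then stops at some level at most `M`, where the
estimate is accurate. The union bound over levels costs only a constant, since the failure
probabilities form a geometric series. An exponential moment bound makes the median of `t`
repetitions fail with probability at most `2⁻ᵗ` (`card_two_mul_ge_le`).

Each repetition performs at most `clog₂ N + 1` bounded counts of at most `K` queries each, and `K =
O(1 / min(1, ε²))`; this holds for every seed. -/

theorem eval_relabel {V V' : Type} (f : V → V') (σ : V' → Bool) (F : BForm V) :
    (F.relabel f).eval σ = F.eval (fun v => σ (f v)) := by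
  induction F <;> simp_all [relabel, eval]

theorem eval_bigConj {V : Type} (σ : V → Bool) (l : List (BForm V)) :
    (bigConj l).eval σ = true ↔ ∀ G ∈ l, G.eval σ = true := by
  induction l with
  | nil => simp [bigConj, eval]
  | cons G l ih =>
    have : bigConj (G :: l) = conj G (bigConj l) := rfl
    simp [this, eval, ih]

theorem eval_bigDisj {V : Type} (σ : V → Bool) (l : List (BForm V)) :
    (bigDisj l).eval σ = true ↔ ∃ G ∈ l, G.eval σ = true := by
  induction l with
  | nil => simp [bigDisj, eval]
  | cons G l ih =>
    have : bigDisj (G :: l) = disj G (bigDisj l) := rfl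
    simp [this, eval, ih]

theorem mem_witnesses {N : ℕ} {F : BForm (Fin N)} {σ : Fin N → Bool} :
    σ ∈ F.witnesses ↔ F.eval σ = true := by
  simp [witnesses]

end BForm

/-! ### Chain formulas -/

/-- Truth value of a chain of connectors `c_j` and truth values `a_j` that ends in `false`. -/
def chainVal : List (Bool × Bool) → Bool
  | [] => false
  | (c, a) :: l => if c then a || chainVal l else a && chainVal l

theorem chainVal_eq_false {l : List (Bool × Bool)} (h : ∀ x ∈ l, x.1 = false) :
    chainVal l = false := by
  induction l with
  | nil => rfl
  | cons x l ih =>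
    obtain ⟨c, a⟩ := x
    have hc : c = false := h (c, a) (by simp)
    simp [chainVal, hc, ih fun x hx => h x (by simp [hx])]

theorem rdropWhile_cons_of_exists {α : Type} (p : α → Bool) (x : α) {l : List α}
    (h : ∃ y ∈ l, p y = false) : (x :: l).rdropWhile p = x :: l.rdropWhile p := by
  unfold List.rdropWhile
  rw [List.reverse_cons, List.dropWhile_append]
  have : (l.reverse.dropWhile p).isEmpty = false := by
    rw [List.isEmpty_eq_false_iff, Ne, List.dropWhile_eq_nil_iff]
    push Not
    simpa using h
  simp [this]

/-- Trailing zero bits are conjunctions ending in `false`, so they contribute `false`, and the last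
one bit then reads `a ∨ false = a`. The cut-off can therefore be ignored, which makes induction on
the number of bits possible. -/
theorem eval_chainList_rdropWhile {V : Type} (τ : V → Bool) (l : List (Bool × V))
    (h : ∃ x ∈ l, x.1 = true) :
    (chainList (l.rdropWhile fun x => !x.1)).eval τ
      = chainVal (l.map fun x => (x.1, τ x.2)) := by
  induction l with
  | nil => simp at h
  | cons x l ih =>
    obtain ⟨c, a⟩ := x
    by_cases hl : ∃ y ∈ l, y.1 = true
    · rw [rdropWhile_cons_of_exists _ _ (by simpa using hl)]
      have hne : (l.rdropWhile fun x => !x.1) ≠ [] := by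
        rw [Ne, List.rdropWhile_eq_nil_iff]
        push Not
        simpa using hl
      obtain ⟨y, l', hyl⟩ := List.exists_cons_of_ne_nil hne
      have ih := ih hl
      rw [hyl] at ih ⊢
      cases c <;> simp [chainList, chainVal, BForm.eval, ih]
    · push Not at hl
      have hc : c = true := by
        obtain ⟨y, hy, hy1⟩ := h
        rcases List.mem_cons.1 hy with rfl | hy
        · exact hy1
        · exact absurd hy1 (hl y hy)
      have hl' : ∀ y ∈ l, y.1 = false := fun y hy => by simpa using hl y hy
      have h1 : ((c, a) :: l).rdropWhile (fun x => !x.1) = [(c, a)] := by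
        have h2 : l.reverse.dropWhile (fun x => !x.1) = [] := by
          rw [List.dropWhile_eq_nil_iff]
          simpa using hl'
        unfold List.rdropWhile
        rw [List.reverse_cons, List.dropWhile_append, h2]
        simp [hc]
      have h3 : chainVal (l.map fun x => (x.1, τ x.2)) = false :=
        chainVal_eq_false (by
          intro x hx
          obtain ⟨y, hy, rfl⟩ := List.mem_map.1 hx
          exact hl' y hy)
      rw [h1]
      simp [chainList, chainVal, BForm.eval, hc, h3]

/-- Condition on the leading variable. If the top bit is 1, the value `true` contributes all `2 ^ m`
completions and `false` the count of the tail; if it is 0, only `true` contributes the count of the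
tail. This is the recursion of `k % 2 ^ (m + 1)`. -/
theorem card_chainVal (k m : ℕ) :
    (Finset.univ.filter fun a : Fin m → Bool =>
      chainVal (List.ofFn fun j : Fin m => (k.testBit (m - 1 - (j : ℕ)), a j)) = true).card
      = k % 2 ^ m := by
  induction m with
  | zero => simp [chainVal, Nat.mod_one]
  | succ m ih =>
    have hlist : ∀ (b : Bool) (a : Fin m → Bool),
        (List.ofFn fun j : Fin (m + 1) =>
          (k.testBit (m + 1 - 1 - (j : ℕ)), (Fin.cons b a : Fin (m + 1) → Bool) j))
        = (k.testBit m, b) :: List.ofFn fun j : Fin m => (k.testBit (m - 1 - (j : ℕ)), a j) := by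
      intro b a
      rw [List.ofFn_succ]
      simp only [Fin.val_zero, Fin.cons_zero, Fin.cons_succ, Fin.val_succ]
      congr 2
      funext j
      congr 2
      omega
    rw [Finset.card_filter, ← (Fin.consEquiv fun _ : Fin (m + 1) => Bool).sum_comp,
      Fintype.sum_prod_type, Fintype.sum_bool]
    simp only [Fin.consEquiv_apply, hlist, chainVal]
    rw [Nat.mod_pow_succ, ← Nat.toNat_testBit, ← ih, Finset.card_filter]
    cases k.testBit m <;> simp [add_comm]

theorem card_chainFormula {V : Type} {k m : ℕ} (hk : 0 < k) (hkm : k ≤ 2 ^ m) (f : Fin m → V)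
    (τ : (Fin m → Bool) → V → Bool) (hτ : ∀ a j, τ a (f j) = a j) :
    (Finset.univ.filter fun a : Fin m → Bool => (chainFormula k m f).eval (τ a) = true).card
      = k := by
  unfold chainFormula
  split_ifs with h
  · simp [BForm.eval, h]
  · have hlt : k < 2 ^ m := lt_of_le_of_ne hkm h
    have hex : ∃ x ∈ (List.ofFn fun j : Fin m => (k.testBit (m - 1 - (j : ℕ)), f j)),
        x.1 = true := by
      -- A set bit of `k` has index below `m` because `k < 2 ^ m`; the list runs from the most
      -- significant bit, hence the index `m - 1 - i`.
      obtain ⟨i, hi⟩ := Nat.exists_testBit_of_ne_zero hk.ne'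
      have him : i < m := by
        by_contra hcon
        rw [Nat.testBit_lt_two_pow (hlt.trans_le (Nat.pow_le_pow_right (by norm_num)
          (not_lt.1 hcon)))] at hi
        exact Bool.noConfusion hi
      refine ⟨(k.testBit i, f ⟨m - 1 - i, by omega⟩), ?_, hi⟩
      rw [List.mem_ofFn]
      refine ⟨⟨m - 1 - i, by omega⟩, ?_⟩
      have : m - 1 - (m - 1 - i) = i := by omega
      simp [this]
    conv_rhs => rw [← Nat.mod_eq_of_lt hlt, ← card_chainVal k m]
    congr 1
    ext a
    rw [Finset.mem_filter, Finset.mem_filter, eval_chainList_rdropWhile _ _ hex, List.map_ofFn]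
    simp [Function.comp_def, hτ]

/-! ### Correctness of the reduction -/

namespace DIQuery

variable {n : ℕ}

/-- Both chain formulas fit into the shared fresh variables. Equality can occur, for instance `p =
1`, `q = 2` with no fresh variable, and is covered by the constant true formula. -/
theorem le_two_pow_bits (Q : DIQuery n) (i : Fin n) :
    Q.p i ≤ 2 ^ Q.bits i ∧ Q.q i - Q.p i ≤ 2 ^ Q.bits i := by
  have key : ∀ k : ℕ, 0 < k → Real.logb 2 (k : ℝ) ≤ (Q.bits i : ℝ) → k ≤ 2 ^ Q.bits i := by
    intro k hk h
    rw [Real.logb_le_iff_le_rpow (by norm_num) (by exact_mod_cast hk), Real.rpow_natCast] at h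
    exact_mod_cast h
  have hb := Nat.le_ceil
    (max (Real.logb 2 (Q.p i : ℝ)) (Real.logb 2 ((Q.q i : ℝ) - (Q.p i : ℝ))))
  have hlt := Q.p_lt_q i
  refine ⟨key _ (Q.p_pos i) ((le_max_left _ _).trans hb), key _ (by omega) ?_⟩
  rw [Nat.cast_sub hlt.le]
  exact (le_max_right _ _).trans hb

/-- Assignments of the variables of the reduced formula: an assignment of the original variables
and, for every original variable, one of its fresh variables. -/
noncomputable def assignEquiv (Q : DIQuery n) :
    (Fin Q.numVars → Bool) ≃ (Fin n → Bool) × ((i : Fin n) → Fin (Q.bits i) → Bool) where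
  toFun τ := (fun i => τ (Q.oldVar i), fun i j => τ (Q.freshVar i j))
  invFun x v := Sum.elim x.1 (fun w => x.2 (finSigmaFinEquiv.symm w).1 (finSigmaFinEquiv.symm w).2)
    (finSumFinEquiv.symm v)
  left_inv τ := by
    funext v
    obtain ⟨w, rfl⟩ := finSumFinEquiv.surjective v
    rcases w with i | w
    · simp [oldVar]
    · obtain ⟨⟨i, j⟩, rfl⟩ := finSigmaFinEquiv.surjective w
      simp [freshVar]
  right_inv x := by
    refine Prod.ext (funext fun i => ?_) (funext fun i => funext fun j => ?_)
    · simp [oldVar]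
    · have h := finSigmaFinEquiv.symm_apply_apply (⟨i, j⟩ : (i : Fin n) × Fin (Q.bits i))
      simp only [freshVar, Equiv.symm_apply_apply, Sum.elim_inr]
      rw [h]

theorem assignEquiv_symm_oldVar (Q : DIQuery n)
    (x : (Fin n → Bool) × ((i : Fin n) → Fin (Q.bits i) → Bool)) (i : Fin n) :
    Q.assignEquiv.symm x (Q.oldVar i) = x.1 i :=
  congrFun (congrArg Prod.fst (Q.assignEquiv.apply_symm_apply x)) i

theorem assignEquiv_symm_freshVar (Q : DIQuery n)
    (x : (Fin n → Bool) × ((i : Fin n) → Fin (Q.bits i) → Bool)) (i : Fin n)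
    (j : Fin (Q.bits i)) : Q.assignEquiv.symm x (Q.freshVar i j) = x.2 i j :=
  congrFun (congrFun (congrArg Prod.snd (Q.assignEquiv.apply_symm_apply x)) i) j

/-- The integer weight of a literal: its weight times the denominator. -/
def natWeight (Q : DIQuery n) (i : Fin n) (b : Bool) : ℕ := if b then Q.p i else Q.q i - Q.p i

/-- The chain formula of the literal `b` of `x_i`, evaluated under an assignment of the fresh
variables of `x_i` only. -/
noncomputable def freshChain (Q : DIQuery n) (i : Fin n) (b : Bool) (a : Fin (Q.bits i) → Bool) :
    Bool :=
  (chainFormula (Q.natWeight i b) (Q.bits i) (id : Fin (Q.bits i) → Fin (Q.bits i))).eval a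

theorem chainList_relabel {V V' : Type} (f : V → V') (l : List (Bool × V)) :
    (chainList l).relabel f = chainList (l.map fun x => (x.1, f x.2)) := by
  induction l with
  | nil => rfl
  | cons x l ih =>
    cases l with
    | nil => rfl
    | cons y l =>
      obtain ⟨c, a⟩ := x
      cases c <;> simp_all [chainList, BForm.relabel]

theorem rdropWhile_map {α β : Type} (f : α → β) (p : β → Bool) (l : List α) :
    (l.map f).rdropWhile p = (l.rdropWhile (p ∘ f)).map f := by
  unfold List.rdropWhile
  rw [← List.map_reverse, List.dropWhile_map, List.map_reverse]

theorem chainFormula_relabel {V V' : Type} (f : V → V') (k m : ℕ) (a : Fin m → V) :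
    (chainFormula k m a).relabel f = chainFormula k m (f ∘ a) := by
  unfold chainFormula
  split_ifs
  · rfl
  · have : (List.ofFn fun j : Fin m => (k.testBit (m - 1 - (j : ℕ)), (f ∘ a) j))
        = (List.ofFn fun j : Fin m => (k.testBit (m - 1 - (j : ℕ)), a j)).map
          fun x => (x.1, f x.2) := by
      rw [List.map_ofFn]
      rfl
    rw [chainList_relabel, this, rdropWhile_map]
    rfl

/-- The value of `x_i` selects one of the two implications and makes the other vacuous. What remains
depends only on the fresh variables of `x_i`, so the count factorizes over `i`. -/
theorem eval_gadget (Q : DIQuery n)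
    (x : (Fin n → Bool) × ((i : Fin n) → Fin (Q.bits i) → Bool)) (i : Fin n) :
    (Q.gadget i).eval (Q.assignEquiv.symm x) = Q.freshChain i (x.1 i) (x.2 i) := by
  have h : ∀ k, (chainFormula k (Q.bits i) (Q.freshVar i)).eval (Q.assignEquiv.symm x)
      = (chainFormula k (Q.bits i) (id : Fin (Q.bits i) → Fin (Q.bits i))).eval (x.2 i) := by
    intro k
    have := chainFormula_relabel (Q.freshVar i) k (Q.bits i) id
    rw [Function.comp_id] at this
    rw [← this, BForm.eval_relabel]
    congr 1
    funext j
    exact Q.assignEquiv_symm_freshVar x i j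
  simp only [gadget, BForm.eval, h, assignEquiv_symm_oldVar, freshChain, natWeight]
  cases x.1 i <;> simp

theorem card_freshChain (Q : DIQuery n) (i : Fin n) (b : Bool) :
    (Finset.univ.filter fun a => Q.freshChain i b a = true).card = Q.natWeight i b := by
  have h1 := Q.le_two_pow_bits i
  have h2 := Q.p_lt_q i
  have h3 := Q.p_pos i
  refine card_chainFormula ?_ ?_ id (fun a => a) (fun _ _ => rfl)
  · unfold natWeight; split_ifs <;> omega
  · unfold natWeight; split_ifs <;> omega

theorem card_witnesses_hatF (Q : DIQuery n) :
    Q.hatF.witnesses.card = ∑ σ ∈ Q.F.witnesses, ∏ i, Q.natWeight i (σ i) := by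
  have heval : ∀ x, Q.hatF.eval (Q.assignEquiv.symm x) = true ↔
      Q.F.eval x.1 = true ∧ ∀ i, Q.freshChain i (x.1 i) (x.2 i) = true := by
    intro x
    simp only [hatF, BForm.eval, Bool.and_eq_true, BForm.eval_relabel, BForm.eval_bigConj,
      List.forall_mem_ofFn_iff, eval_gadget, assignEquiv_symm_oldVar]
  have hpi : ∀ σ : Fin n → Bool,
      (∏ i, Q.natWeight i (σ i)) = ∑ a : (i : Fin n) → Fin (Q.bits i) → Bool,
        if ∀ i, Q.freshChain i (σ i) (a i) = true then 1 else 0 := by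
    intro σ
    rw [← Finset.card_filter]
    simp only [← card_freshChain]
    -- The product of the counts is the size of the product set of admissible fresh assignments.
    rw [← Fintype.card_piFinset]
    congr 1
    ext a
    simp
  unfold BForm.witnesses
  rw [Finset.card_filter, ← Q.assignEquiv.symm.sum_comp, Fintype.sum_prod_type, Finset.sum_filter]
  refine Finset.sum_congr rfl fun σ _ => ?_
  simp only [heval, hpi]
  by_cases h : Q.F.eval σ = true <;> simp [h]

theorem normC_pos (Q : DIQuery n) : 0 < Q.normC :=
  Finset.prod_pos fun i _ => by exact_mod_cast (Q.p_pos i).trans (Q.p_lt_q i)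

theorem weight_mul_normC (Q : DIQuery n) : Q.weight * Q.normC = (Q.hatF.witnesses.card : ℝ) := by
  rw [card_witnesses_hatF, weight, Finset.sum_mul, Nat.cast_sum]
  refine Finset.sum_congr rfl fun σ _ => ?_
  rw [assignWeight, normC, ← Finset.prod_mul_distrib, Nat.cast_prod]
  refine Finset.prod_congr rfl fun i _ => ?_
  have hq : (Q.q i : ℝ) ≠ 0 := by exact_mod_cast ((Q.p_pos i).trans (Q.p_lt_q i)).ne'
  cases σ i
  · simp only [litWeight, natWeight, Bool.false_eq_true, if_false, Nat.cast_sub (Q.p_lt_q i).le]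
    field_simp
  · simp [litWeight, natWeight, hq]

end DIQuery

/-! ### Oracle computations -/

namespace OracleProg

theorem value_bind {α β : Type} (P : OracleProg α) (f : α → OracleProg β) :
    (P.bind f).value = (f P.value).value := by
  induction P with
  | ret a => rfl
  | ask G k ih => exact ih _

theorem calls_bind {α β : Type} (P : OracleProg α) (f : α → OracleProg β) :
    (P.bind f).calls = P.calls + (f P.value).calls := by
  induction P with
  | ret a => simp [bind, calls, value]
  | ask G k ih => simp [bind, calls, value, ih]; omega

theorem value_runAll {α : Type} (l : List (OracleProg α)) :
    (runAll l).value = l.map value := by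
  induction l with
  | nil => rfl
  | cons P l ih => simp [runAll, value_bind, ih, value]

theorem calls_runAll {α : Type} (l : List (OracleProg α)) :
    (runAll l).calls = (l.map calls).sum := by
  induction l with
  | nil => rfl
  | cons P l ih => simp [runAll, calls_bind, ih, calls]

end OracleProg

/-- The algorithm returns an estimate of the weight whenever the model counter returns an estimate
of the number of witnesses of the reduced formula. -/
theorem isEstimate_algA {B : ModelCounter} (hB : IsApproxModelCounter B) {n : ℕ} (Q : DIQuery n)
    {ε δ : ℝ} (hε : 0 < ε) (hδ : 0 < δ) (hδ1 : δ ≤ 1) :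
    IsEstimate (algA B Q ε δ) ε δ Q.weight := by
  have h := hB Q.numVars Q.hatF ε δ hε hδ hδ1
  have hc := Q.normC_pos
  unfold IsEstimate at h ⊢
  refine h.trans (le_of_eq ?_)
  change _ = (B Q.numVars Q.hatF ε δ).law.toOuterMeasure _
  congr 1
  ext s
  change _ ↔ Q.weight / (1 + ε) ≤ (((B Q.numVars Q.hatF ε δ).prog s).bind _).value ∧
    (((B Q.numVars Q.hatF ε δ).prog s).bind _).value ≤ (1 + ε) * Q.weight
  rw [OracleProg.value_bind]
  simp only [Set.mem_ofPred_eq, OracleProg.value, ← Q.weight_mul_normC]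
  rw [le_div_iff₀ hc, div_le_iff₀ hc, div_mul_eq_mul_div, mul_assoc]

/-! ### Counting witnesses with the oracle -/

theorem satOracle_eq_true {G : BForm ℕ} : satOracle G = true ↔ ∃ σ : ℕ → Bool, G.eval σ = true := by
  simp [satOracle]

theorem eval_atLeast {N : ℕ} (G : BForm (Fin N)) (k : ℕ) (σ : ℕ → Bool) :
    (atLeast G k).eval σ = true ↔
      (∀ c : Fin k, G.eval (fun v : Fin N => σ (Nat.pair c v)) = true) ∧
      ∀ (c : Fin k) (d : Fin (c : ℕ)), ∃ v : Fin N, σ (Nat.pair c v) ≠ σ (Nat.pair d v) := by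
  simp [atLeast, BForm.eval, BForm.eval_bigConj, BForm.eval_bigDisj, BForm.eval_relabel,
    List.mem_ofFn]

/-- A model of `atLeast G k` is an injective listing of `k` witnesses, the `c`-th one stored at the
variables `Nat.pair c v`. -/
theorem satOracle_atLeast {N : ℕ} (G : BForm (Fin N)) (k : ℕ) :
    satOracle (atLeast G k) = true ↔ k ≤ G.witnesses.card := by
  rw [satOracle_eq_true]
  constructor
  · rintro ⟨σ, hσ⟩
    obtain ⟨h1, h2⟩ := (eval_atLeast G k σ).1 hσ
    have hne : ∀ c d : Fin k, d < c →
        (fun v : Fin N => σ (Nat.pair c v)) ≠ fun v : Fin N => σ (Nat.pair d v) := by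
      intro c d hdc heq
      obtain ⟨v, hv⟩ := h2 c ⟨d, hdc⟩
      exact hv (congrFun heq v)
    have hinj : Function.Injective fun (c : Fin k) (v : Fin N) => σ (Nat.pair c v) := by
      intro c d hcd
      rcases lt_trichotomy c d with h | h | h
      · exact absurd hcd.symm (hne d c h)
      · exact h
      · exact absurd hcd (hne c d h)
    have := Finset.card_le_card_of_injOn (s := (Finset.univ : Finset (Fin k)))
      (t := G.witnesses) (fun c v => σ (Nat.pair c v))
      (fun c _ => BForm.mem_witnesses.2 (h1 c)) (hinj.injOn)
    simpa using this
  · intro hk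
    obtain ⟨S, hS, hSk⟩ := Finset.exists_subset_card_eq hk
    let e : Fin k ≃ S := (finCongr hSk.symm).trans S.equivFin.symm
    obtain ⟨σ, hval⟩ : ∃ σ : ℕ → Bool, ∀ (c : ℕ) (hc : c < k) (v : Fin N),
        σ (Nat.pair c v) = (e ⟨c, hc⟩).1 v :=
      ⟨fun w => if h : (Nat.unpair w).1 < k ∧ (Nat.unpair w).2 < N then
        (e ⟨(Nat.unpair w).1, h.1⟩).1 ⟨(Nat.unpair w).2, h.2⟩ else false, by
          intro c hc v
          simp [hc]⟩
    refine ⟨σ, ?_⟩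
    rw [eval_atLeast]
    constructor
    · intro c
      simp only [hval c c.2]
      exact BForm.mem_witnesses.1 (hS (e c).2)
    · intro c d
      have hd : (d : ℕ) < k := d.2.trans c.2
      have hne : (e c).1 ≠ (e ⟨d, hd⟩).1 := by
        intro h
        have := congrArg Fin.val (e.injective (Subtype.ext h))
        have := d.2
        simp_all
      obtain ⟨v, hv⟩ := Function.ne_iff.1 hne
      refine ⟨v, ?_⟩
      rw [hval c c.2, hval d hd]
      exact hv

theorem value_countFrom {N : ℕ} (G : BForm (Fin N)) (r c : ℕ) (hc : c ≤ G.witnesses.card) :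
    (countFrom G r c).value = min G.witnesses.card (c + r) := by
  induction r generalizing c with
  | zero => simp [countFrom, OracleProg.value, hc]
  | succ r ih =>
    have h := satOracle_atLeast G (c + 1)
    rw [countFrom, OracleProg.value]
    split_ifs with hs
    · rw [ih _ (h.1 hs)]
      congr 1
      omega
    · have : ¬ c + 1 ≤ G.witnesses.card := fun h' => hs (h.2 h')
      rw [OracleProg.value]
      omega

theorem calls_countFrom_le {N : ℕ} (G : BForm (Fin N)) (r c : ℕ) :
    (countFrom G r c).calls ≤ r := by
  induction r generalizing c with
  | zero => simp [countFrom, OracleProg.calls]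
  | succ r ih =>
    rw [countFrom, OracleProg.calls]
    split_ifs with hs
    · exact Nat.succ_le_succ (ih _)
    · simp [OracleProg.calls]

theorem value_boundedCount {N : ℕ} (G : BForm (Fin N)) (K : ℕ) :
    (boundedCount G K).value = min G.witnesses.card K := by
  rw [boundedCount, value_countFrom G K 0 (Nat.zero_le _), Nat.zero_add]

theorem calls_boundedCount_le {N : ℕ} (G : BForm (Fin N)) (K : ℕ) :
    (boundedCount G K).calls ≤ K := calls_countFrom_le G K 0

/-! ### Binary search -/

theorem cellSearch_of_le {N : ℕ} (G : ℕ → BForm (Fin N)) {K lo hi : ℕ} (h : hi ≤ lo + 1) :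
    cellSearch G K lo hi = OracleProg.ret hi := by
  rw [cellSearch, if_pos h]

theorem cellSearch_of_lt {N : ℕ} (G : ℕ → BForm (Fin N)) {K lo hi : ℕ} (h : ¬ hi ≤ lo + 1) :
    cellSearch G K lo hi = (boundedCount (G ((lo + hi) / 2)) K).bind fun c =>
      if c < K then cellSearch G K lo ((lo + hi) / 2)
      else cellSearch G K ((lo + hi) / 2) hi := by
  rw [cellSearch, if_neg h]

/-- Each round halves the interval up to rounding, and the bound `2 ^ d` absorbs the rounding. No
monotonicity of `G` is needed. -/
theorem calls_cellSearch_le {N : ℕ} (G : ℕ → BForm (Fin N)) (K : ℕ) :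
    ∀ (d lo hi : ℕ), hi - lo ≤ 2 ^ d → (cellSearch G K lo hi).calls ≤ d * K := by
  intro d
  induction d with
  | zero =>
    intro lo hi h
    rw [cellSearch_of_le G (by simp at h; omega)]
    simp [OracleProg.calls]
  | succ d ih =>
    intro lo hi h
    by_cases hle : hi ≤ lo + 1
    · rw [cellSearch_of_le G hle]
      simp [OracleProg.calls]
    · rw [cellSearch_of_lt G hle, OracleProg.calls_bind, Nat.succ_mul, Nat.add_comm]
      rw [pow_succ] at h
      refine Nat.add_le_add ?_ (calls_boundedCount_le _ K)
      split_ifs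
      · exact ih _ _ (by omega)
      · exact ih _ _ (by omega)

/-- The binary search finds the first index in `(lo, hi]` at which there are fewer than `K`
witnesses, if there is one. -/
theorem value_cellSearch {N : ℕ} (G : ℕ → BForm (Fin N)) (K : ℕ)
    (hG : Antitone fun m => (G m).witnesses.card) (d lo hi : ℕ) (hd : hi - lo ≤ d) (hlt : lo < hi)
    (hlo : K ≤ (G lo).witnesses.card) (hhi : (G hi).witnesses.card < K) :
    lo < (cellSearch G K lo hi).value ∧ (G (cellSearch G K lo hi).value).witnesses.card < K ∧
      ∀ j, (G j).witnesses.card < K → (cellSearch G K lo hi).value ≤ j := by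
  induction d generalizing lo hi with
  | zero => omega
  | succ d ih =>
    by_cases hle : hi ≤ lo + 1
    · rw [cellSearch_of_le G hle]
      refine ⟨hlt, hhi, fun j hj => ?_⟩
      simp only [OracleProg.value]
      by_contra hcon
      have : (G lo).witnesses.card ≤ (G j).witnesses.card := hG (by omega : j ≤ lo)
      omega
    · rw [cellSearch_of_lt G hle, OracleProg.value_bind, value_boundedCount]
      split_ifs with hc
      · exact ih _ _ (by omega) (by omega) hlo (by omega)
      · obtain ⟨h1, h2, h3⟩ :=
          ih ((lo + hi) / 2) hi (by omega) (by omega) (by omega) hhi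
        exact ⟨by omega, h2, h3⟩

/-! ### Random XOR constraints -/

/-- The sign `-1` of `true` and `1` of `false`. -/
def boolSign (b : Bool) : ℤ := if b then -1 else 1

theorem boolSign_xor (a b : Bool) : boolSign (Bool.xor a b) = boolSign a * boolSign b := by
  cases a <;> cases b <;> rfl

theorem boolSign_injective : Function.Injective boolSign := by
  intro a b
  cases a <;> cases b <;> simp [boolSign]

/-- Signs turn the XOR fold into a product over all coordinates, from which a single factor can be
split off when one coefficient is changed. -/
theorem boolSign_eval_xorConstraint {N : ℕ} (a : Fin N → Bool) (b : Bool) (σ : Fin N → Bool) :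
    boolSign ((xorConstraint (a, b)).eval σ)
      = (∏ v, boolSign (a v && σ v)) * boolSign (!b) := by
  have key : ∀ (l : List (Fin N)) (G : BForm (Fin N)),
      boolSign (((l.filter a).foldr (fun v G => BForm.xor (BForm.var v) G) G).eval σ)
        = (l.map fun v => boolSign (a v && σ v)).prod * boolSign (G.eval σ) := by
    intro l G
    induction l with
    | nil => simp
    | cons v l ih =>
      cases h : a v
      · simp [h, ih, show boolSign false = 1 from rfl]
      · simp [h, BForm.eval, boolSign_xor, ih, mul_assoc]
  rw [xorConstraint, key, ← List.ofFn_eq_map, List.prod_ofFn]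
  cases b <;> simp [BForm.eval]

theorem eval_xorConstraint_not {N : ℕ} (a : Fin N → Bool) (b : Bool) (σ : Fin N → Bool) :
    (xorConstraint (a, !b)).eval σ = !(xorConstraint (a, b)).eval σ := by
  have h : (xorConstraint (a, !b)).eval σ = Bool.xor true ((xorConstraint (a, b)).eval σ) := by
    apply boolSign_injective
    rw [boolSign_xor, boolSign_eval_xorConstraint, boolSign_eval_xorConstraint]
    cases b <;> simp [boolSign]
  rw [h, Bool.true_xor]

theorem eval_xorConstraint_update {N : ℕ} (a : Fin N → Bool) (b : Bool) (v : Fin N)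
    (σ : Fin N → Bool) :
    (xorConstraint (Function.update a v (!a v), b)).eval σ
      = Bool.xor (σ v) ((xorConstraint (a, b)).eval σ) := by
  apply boolSign_injective
  rw [boolSign_xor, boolSign_eval_xorConstraint, boolSign_eval_xorConstraint,
    ← Finset.mul_prod_erase Finset.univ _ (Finset.mem_univ v),
    ← Finset.mul_prod_erase Finset.univ (fun u => boolSign (a u && σ u)) (Finset.mem_univ v),
    Function.update_self]
  have : ∀ u ∈ Finset.univ.erase v,
      boolSign (Function.update a v (!a v) u && σ u) = boolSign (a u && σ u) := by
    intro u hu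
    rw [Function.update_of_ne (Finset.ne_of_mem_erase hu)]
  rw [Finset.prod_congr rfl this]
  cases a v <;> cases σ v <;> simp [boolSign]

/-- An involution that preserves `p` and negates `q` shows that `q` holds on half of `p`. -/
theorem two_mul_card_filter_and {Ω : Type} [Fintype Ω] (p q : Ω → Bool) (T : Ω → Ω)
    (hT : Function.Involutive T) (hp : ∀ ω, p (T ω) = p ω) (hq : ∀ ω, q (T ω) = !q ω) :
    2 * (Finset.univ.filter fun ω => p ω = true ∧ q ω = true).card
      = (Finset.univ.filter fun ω => p ω = true).card := by
  have h1 : (Finset.univ.filter fun ω => p ω = true ∧ q ω = true).card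
      = (Finset.univ.filter fun ω => p ω = true ∧ ¬ q ω = true).card := by
    refine Finset.card_bij' (fun ω _ => T ω) (fun ω _ => T ω) ?_ ?_ ?_ ?_
    · intro ω; simp [hp, hq]
    · intro ω; simp [hp, hq]
    · intro ω _; exact hT ω
    · intro ω _; exact hT ω
  have h2 := Finset.card_filter_add_card_filter_not
    (s := Finset.univ.filter fun ω => p ω = true) (fun ω => q ω = true)
  rw [Finset.filter_filter, Finset.filter_filter] at h2
  omega

/-- The constraints that the assignment `x` satisfies. -/
def satConstraints {N : ℕ} (x : Fin N → Bool) : Finset ((Fin N → Bool) × Bool) :=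
  Finset.univ.filter fun r => (xorConstraint r).eval x = true

theorem two_mul_card_satConstraints {N : ℕ} (x : Fin N → Bool) :
    2 * (satConstraints x).card = Fintype.card ((Fin N → Bool) × Bool) := by
  have := two_mul_card_filter_and (fun _ : (Fin N → Bool) × Bool => true)
    (fun r => (xorConstraint r).eval x) (fun r => (r.1, !r.2)) (fun r => by simp) (fun _ => rfl)
    (fun r => eval_xorConstraint_not r.1 r.2 x)
  simpa [satConstraints] using this

/-- Choose `v` with `x v ≠ y v`. Flipping the coefficient of `v` and adding `x v` to the right-hand
side is an involution that preserves the constraint at `x` and negates it at `y`. So half of the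
constraints satisfied by `x` are also satisfied by `y`. -/
theorem four_mul_card_satConstraints_inter {N : ℕ} {x y : Fin N → Bool} (hxy : x ≠ y) :
    4 * (satConstraints x ∩ satConstraints y).card = Fintype.card ((Fin N → Bool) × Bool) := by
  obtain ⟨v, hv⟩ := Function.ne_iff.1 hxy
  have h := two_mul_card_filter_and (fun r : (Fin N → Bool) × Bool => (xorConstraint r).eval x)
    (fun r => (xorConstraint r).eval y)
    (fun r => (Function.update r.1 v (!r.1 v), Bool.xor (x v) r.2))
    (fun r => by
      refine Prod.ext ?_ ?_
      · simp
      · cases x v <;> simp)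
    (fun r => by
      cases hx : x v
      · simp [eval_xorConstraint_update, hx]
      · simp [eval_xorConstraint_update, eval_xorConstraint_not, hx])
    (fun r => by
      cases hx : x v
      · have hy : y v = true := by cases h : y v <;> simp_all
        simp [eval_xorConstraint_update, hy]
      · have hy : y v = false := by cases h : y v <;> simp_all
        simp [eval_xorConstraint_update, eval_xorConstraint_not, hy])
  have h2 := two_mul_card_satConstraints x
  rw [satConstraints] at h2
  rw [satConstraints, satConstraints, ← Finset.filter_and]
  omega

/-- Independence of the constraints: the event is a product set. It is used with `q = 2` for one
point and `q = 4` for a pair. -/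
theorem pow_mul_card_forall_lt {Ω : Type} [Fintype Ω] [DecidableEq Ω] {N m q : ℕ} (hm : m ≤ N)
    (s : Finset Ω) (hs : q * s.card = Fintype.card Ω) :
    q ^ m * (Finset.univ.filter fun h : Fin N → Ω => ∀ i : Fin N, (i : ℕ) < m → h i ∈ s).card
      = Fintype.card (Fin N → Ω) := by
  have h1 : (Finset.univ.filter fun h : Fin N → Ω => ∀ i : Fin N, (i : ℕ) < m → h i ∈ s)
      = Fintype.piFinset fun i : Fin N => if (i : ℕ) < m then s else Finset.univ := by
    ext h
    simp only [Finset.mem_filter, Finset.mem_univ, true_and, Fintype.mem_piFinset]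
    refine forall_congr' fun i => ?_
    split_ifs with hi <;> simp [hi]
  have h2 : q ^ m = ∏ i : Fin N, if (i : ℕ) < m then q else 1 := by
    rw [Fin.prod_univ_eq_prod_range (fun i => if i < m then q else 1) N,
      ← Finset.prod_filter]
    have : (Finset.range N).filter (· < m) = Finset.range m := by
      ext i
      simp
      omega
    rw [this, Finset.prod_const, Finset.card_range]
  rw [h1, Fintype.card_piFinset, h2, ← Finset.prod_mul_distrib, Fintype.card_pi]
  refine Finset.prod_congr rfl fun i _ => ?_
  split_ifs
  · exact hs
  · simp

/-! ### Cells -/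

/-- The random choices of one repetition. -/
abbrev HashSeed (N : ℕ) : Type := Fin N → (Fin N → Bool) × Bool

/-- The number of witnesses in the cell of the first `m` constraints. -/
def cellCard {N : ℕ} (F : BForm (Fin N)) (m : ℕ) (h : HashSeed N) : ℕ :=
  (cellFormula F h m).witnesses.card

theorem witnesses_cellFormula {N : ℕ} (F : BForm (Fin N)) (h : HashSeed N) (m : ℕ) :
    (cellFormula F h m).witnesses
      = F.witnesses.filter fun x => ∀ i : Fin N, (i : ℕ) < m → h i ∈ satConstraints x := by
  ext x
  rw [Finset.mem_filter, BForm.mem_witnesses, BForm.mem_witnesses, cellFormula, BForm.eval,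
    Bool.and_eq_true, BForm.eval_bigConj]
  refine and_congr_right fun _ => ?_
  constructor
  · intro H i hi
    have : xorConstraint (h i) ∈ ((List.ofFn h).take m).map xorConstraint := by
      refine List.mem_map_of_mem ?_
      rw [List.mem_take_iff_getElem]
      exact ⟨i, by simpa using hi, by simp⟩
    simpa [satConstraints] using H _ this
  · intro H G hG
    obtain ⟨r, hr, rfl⟩ := List.mem_map.1 hG
    obtain ⟨i, hi, rfl⟩ := List.mem_take_iff_getElem.1 hr
    rw [List.length_ofFn, lt_min_iff] at hi
    simpa [satConstraints] using H ⟨i, hi.2⟩ hi.1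

theorem cellCard_zero {N : ℕ} (F : BForm (Fin N)) (h : HashSeed N) :
    cellCard F 0 h = F.witnesses.card := by
  simp [cellCard, witnesses_cellFormula]

theorem antitone_cellCard {N : ℕ} (F : BForm (Fin N)) (h : HashSeed N) :
    Antitone fun m => cellCard F m h := by
  intro m m' hm
  simp only [cellCard, witnesses_cellFormula]
  refine Finset.card_le_card fun x => ?_
  simp only [Finset.mem_filter]
  exact fun H => ⟨H.1, fun i hi => H.2 i (hi.trans_le hm)⟩

/-- The expected number of witnesses in the cell of the first `m` constraints. -/
noncomputable def cellMean {N : ℕ} (F : BForm (Fin N)) (m : ℕ) : ℝ := F.witnesses.card / 2 ^ m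

theorem cellCard_eq_sum {N : ℕ} (F : BForm (Fin N)) (m : ℕ) (h : HashSeed N) :
    (cellCard F m h : ℝ) = ∑ x ∈ F.witnesses,
      if ∀ i : Fin N, (i : ℕ) < m → h i ∈ satConstraints x then (1 : ℝ) else 0 := by
  rw [cellCard, witnesses_cellFormula, Finset.sum_boole]

theorem sum_cellCard {N : ℕ} (F : BForm (Fin N)) {m : ℕ} (hm : m ≤ N) :
    ∑ h : HashSeed N, (cellCard F m h : ℝ) = Fintype.card (HashSeed N) * cellMean F m := by
  simp only [cellCard_eq_sum]
  rw [Finset.sum_comm]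
  have : ∀ x ∈ F.witnesses, (∑ h : HashSeed N,
      if ∀ i : Fin N, (i : ℕ) < m → h i ∈ satConstraints x then (1 : ℝ) else 0)
      = Fintype.card (HashSeed N) / 2 ^ m := by
    intro x _
    rw [Finset.sum_boole, eq_div_iff (by positivity), mul_comm]
    exact_mod_cast pow_mul_card_forall_lt hm _ (two_mul_card_satConstraints x)
  rw [Finset.sum_congr rfl this, Finset.sum_const, nsmul_eq_mul, cellMean]
  ring

/-- Expand the square over pairs of witnesses: distinct pairs survive with probability `4⁻ᵐ` and
give at most `μ²`, the diagonal survives with probability `2⁻ᵐ` and gives `μ`. -/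
theorem sum_cellCard_sq_le {N : ℕ} (F : BForm (Fin N)) {m : ℕ} (hm : m ≤ N) :
    ∑ h : HashSeed N, (cellCard F m h : ℝ) ^ 2
      ≤ Fintype.card (HashSeed N) * (cellMean F m + cellMean F m ^ 2) := by
  have hsq : ∀ h : HashSeed N, (cellCard F m h : ℝ) ^ 2
      = ∑ x ∈ F.witnesses, ∑ y ∈ F.witnesses,
        if ∀ i : Fin N, (i : ℕ) < m → h i ∈ satConstraints x ∩ satConstraints y
        then (1 : ℝ) else 0 := by
    intro h
    rw [sq, cellCard_eq_sum, Finset.sum_mul_sum]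
    refine Finset.sum_congr rfl fun x _ => Finset.sum_congr rfl fun y _ => ?_
    rw [ite_zero_mul_ite_zero, one_mul]
    refine if_congr ?_ rfl rfl
    simp only [Finset.mem_inter]
    exact ⟨fun H i hi => ⟨H.1 i hi, H.2 i hi⟩,
      fun H => ⟨fun i hi => (H i hi).1, fun i hi => (H i hi).2⟩⟩
  have hterm : ∀ x ∈ F.witnesses, ∀ y ∈ F.witnesses, (∑ h : HashSeed N,
      if ∀ i : Fin N, (i : ℕ) < m → h i ∈ satConstraints x ∩ satConstraints y
        then (1 : ℝ) else 0)
      ≤ Fintype.card (HashSeed N) / 4 ^ m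
        + if x = y then (Fintype.card (HashSeed N) : ℝ) / 2 ^ m else 0 := by
    intro x _ y _
    rw [Finset.sum_boole]
    split_ifs with hxy
    · subst hxy
      rw [Finset.inter_self]
      have : (2 : ℝ) ^ m * (Finset.univ.filter fun h : HashSeed N =>
          ∀ i : Fin N, (i : ℕ) < m → h i ∈ satConstraints x).card
          = Fintype.card (HashSeed N) := by
        exact_mod_cast pow_mul_card_forall_lt hm _ (two_mul_card_satConstraints x)
      rw [mul_comm, ← eq_div_iff (by positivity)] at this
      rw [this]
      -- The `4⁻ᵐ` term is slack on the diagonal; keeping it makes the double sum come out as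
      -- exactly `μ² + μ`.
      exact le_add_of_nonneg_left (by positivity)
    · rw [add_zero, le_div_iff₀ (by positivity), mul_comm]
      exact_mod_cast
        (pow_mul_card_forall_lt hm _ (four_mul_card_satConstraints_inter hxy)).le
  simp only [hsq]
  rw [Finset.sum_comm]
  calc _ = ∑ x ∈ F.witnesses, ∑ y ∈ F.witnesses, ∑ h : HashSeed N,
        (if ∀ i : Fin N, (i : ℕ) < m → h i ∈ satConstraints x ∩ satConstraints y
        then (1 : ℝ) else 0) := Finset.sum_congr rfl fun x _ => Finset.sum_comm
    _ ≤ ∑ x ∈ F.witnesses, ∑ y ∈ F.witnesses, ((Fintype.card (HashSeed N) : ℝ) / 4 ^ m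
        + if x = y then (Fintype.card (HashSeed N) : ℝ) / 2 ^ m else 0) :=
      Finset.sum_le_sum fun x hx => Finset.sum_le_sum fun y hy => hterm x hx y hy
    _ = ∑ x ∈ F.witnesses, (F.witnesses.card * ((Fintype.card (HashSeed N) : ℝ) / 4 ^ m)
        + (Fintype.card (HashSeed N) : ℝ) / 2 ^ m) := by
      refine Finset.sum_congr rfl fun x hx => ?_
      rw [Finset.sum_add_distrib, Finset.sum_const, nsmul_eq_mul, Finset.sum_ite_eq, if_pos hx]
    _ = _ := by
      rw [Finset.sum_const, nsmul_eq_mul, cellMean]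
      have : (4 : ℝ) ^ m = 2 ^ m * 2 ^ m := by rw [← mul_pow]; norm_num
      rw [this]
      field_simp
      ring

theorem sum_sub_cellMean_sq_le {N : ℕ} (F : BForm (Fin N)) {m : ℕ} (hm : m ≤ N) :
    ∑ h : HashSeed N, ((cellCard F m h : ℝ) - cellMean F m) ^ 2
      ≤ Fintype.card (HashSeed N) * cellMean F m := by
  have h1 := sum_cellCard F hm
  have h2 := sum_cellCard_sq_le F hm
  have : ∑ h : HashSeed N, ((cellCard F m h : ℝ) - cellMean F m) ^ 2
      = ∑ h : HashSeed N, (cellCard F m h : ℝ) ^ 2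
        - 2 * cellMean F m * ∑ h : HashSeed N, (cellCard F m h : ℝ)
        + Fintype.card (HashSeed N) * cellMean F m ^ 2 := by
    rw [Finset.mul_sum, ← Finset.sum_sub_distrib, ← nsmul_eq_mul, ← Finset.card_univ,
      ← Finset.sum_const, ← Finset.sum_add_distrib]
    exact Finset.sum_congr rfl fun h _ => by ring
  rw [this, h1]
  linarith

/-- Chebyshev's inequality for the size of a cell. -/
theorem card_deviation_le {N : ℕ} (F : BForm (Fin N)) {m : ℕ} (hm : m ≤ N) {a : ℝ} (ha : 0 < a)
    (S : Finset (HashSeed N))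
    (hS : ∀ h ∈ S, a ^ 2 ≤ ((cellCard F m h : ℝ) - cellMean F m) ^ 2) :
    (S.card : ℝ) ≤ Fintype.card (HashSeed N) * (cellMean F m / a ^ 2) := by
  rw [← mul_div_assoc, le_div_iff₀ (by positivity)]
  calc (S.card : ℝ) * a ^ 2 = ∑ _h ∈ S, a ^ 2 := by rw [Finset.sum_const, nsmul_eq_mul]
    _ ≤ ∑ h ∈ S, ((cellCard F m h : ℝ) - cellMean F m) ^ 2 := Finset.sum_le_sum hS
    _ ≤ ∑ h : HashSeed N, ((cellCard F m h : ℝ) - cellMean F m) ^ 2 :=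
      Finset.sum_le_sum_of_subset_of_nonneg (Finset.subset_univ _) fun _ _ _ => sq_nonneg _
    _ ≤ _ := sum_sub_cellMean_sq_le F hm

/-! ### One repetition of the counter -/

/-- The numerical core of the choice of `K`. With `M = r * K`, the bounds `K ≥ 128 * A` and `K ≥
129` leave a one-variable inequality for `r` in `[3/10, 6/10]`. -/
theorem threshold_tail_le {A K M : ℝ} (hA : 1 ≤ A) (hK : 128 * A + 1 ≤ K) (h1 : 3 / 10 * K < M)
    (h2 : M ≤ 6 / 10 * K) : 2 * A / M + M / (K - M) ^ 2 ≤ 1 / 16 := by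
  have hK0 : 0 < K := by linarith
  obtain ⟨r, rfl⟩ : ∃ r, M = r * K := ⟨M / K, by field_simp⟩
  have hr1 : 3 / 10 < r := lt_of_mul_lt_mul_right h1 hK0.le
  have hr2 : r ≤ 6 / 10 := le_of_mul_le_mul_right h2 hK0
  have hr : 0 < r := by linarith
  have hs : 0 < 1 - r := by linarith
  have e1 : 2 * A / (r * K) ≤ 1 / (64 * r) := by
    rw [div_le_div_iff₀ (by positivity) (by positivity)]
    nlinarith
  have e2 : r * K / (K - r * K) ^ 2 ≤ r / (129 * (1 - r) ^ 2) := by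
    have : r * K / (K - r * K) ^ 2 = r / (K * (1 - r) ^ 2) := by
      have : K - r * K = K * (1 - r) := by ring
      rw [this]
      field_simp
    rw [this]
    refine div_le_div_of_nonneg_left hr.le (by positivity) ?_
    have := sq_nonneg (1 - r)
    nlinarith
  refine (add_le_add e1 e2).trans ?_
  rw [div_add_div _ _ (by positivity) (by positivity), div_le_div_iff₀ (by positivity) (by norm_num)]
  -- After clearing denominators the claim is `516r³ - 1225r² + 774r - 129 ≥ 0`. The hinted product
  -- has the same leading term, and the difference `7.8 - 2.88r - 0.6r²` is positive for `r ≤ 6/10`.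
  nlinarith [mul_nonneg (mul_nonneg (sub_nonneg.2 hr1.le) (sub_nonneg.2 hr2))
    (by linarith : (0 : ℝ) ≤ 760 - 516 * r)]

theorem le_cellThreshold (ε : ℝ) : 128 * (1 + 1 / ε) ^ 2 + 1 ≤ (cellThreshold ε : ℝ) := by
  rw [cellThreshold]
  push_cast
  linarith [Nat.le_ceil (128 * (1 + 1 / ε) ^ 2)]

/-- The repetition with randomness `h` returns a value within the tolerance. -/
def GoodSeed {N : ℕ} (F : BForm (Fin N)) (ε : ℝ) (h : HashSeed N) : Prop :=
  (F.witnesses.card : ℝ) / (1 + ε) ≤ (cellEstimate F (cellThreshold ε) h).value ∧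
    ((cellEstimate F (cellThreshold ε) h).value : ℝ) ≤ (1 + ε) * F.witnesses.card

/-- Means halve from level to level, from at least `K` at level 0 to at most 1 at level `N`. The
first one not above `0.6 * K` is therefore above `0.3 * K`. -/
theorem exists_cellMean_mem {N : ℕ} (F : BForm (Fin N)) {K : ℝ} (hK : 2 ≤ K)
    (hF : K ≤ F.witnesses.card) :
    ∃ m ≤ N, 3 / 10 * K < cellMean F m ∧ cellMean F m ≤ 6 / 10 * K := by
  have hN : cellMean F N ≤ 6 / 10 * K := by
    have : F.witnesses.card ≤ 2 ^ N := by
      simpa using Finset.card_le_univ F.witnesses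
    have : (F.witnesses.card : ℝ) ≤ 2 ^ N := by exact_mod_cast this
    rw [cellMean, div_le_iff₀ (by positivity)]
    nlinarith [show (0 : ℝ) < 2 ^ N by positivity]
  have hex : ∃ m, cellMean F m ≤ 6 / 10 * K := ⟨N, hN⟩
  classical
  refine ⟨Nat.find hex, Nat.find_min' hex hN, ?_, Nat.find_spec hex⟩
  rcases h : Nat.find hex with _ | m
  · simp only [cellMean, pow_zero, div_one]
    linarith
  · have hlt := Nat.find_min hex (m := m) (by omega)
    have : cellMean F (m + 1) = cellMean F m / 2 := by
      rw [cellMean, cellMean, pow_succ, div_mul_eq_div_div]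
    rw [this]
    linarith

/-- If all cells up to the level `M` are close to their means and the cell at level `M` is small,
then the estimate is good. -/
theorem goodSeed_of_forall {N : ℕ} (F : BForm (Fin N)) {ε : ℝ} (hε : 0 < ε) (h : HashSeed N)
    (hF : cellThreshold ε ≤ F.witnesses.card) {M : ℕ} (hMN : M ≤ N)
    (hM : cellCard F M h < cellThreshold ε)
    (hdev : ∀ m ≤ M, ((cellCard F m h : ℝ) - cellMean F m) ^ 2
      < (cellMean F m * (ε / (1 + ε))) ^ 2) : GoodSeed F ε h := by
  have h0 : cellCard F 0 h = F.witnesses.card := cellCard_zero F h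
  have hM0 : M ≠ 0 := by
    rintro rfl
    omega
  have hanti := antitone_cellCard F h
  obtain ⟨-, h2, h3⟩ := value_cellSearch (cellFormula F h) (cellThreshold ε) hanti N 0 N
    (by omega) (by omega) (by change _ ≤ cellCard F 0 h; omega) ((hanti hMN).trans_lt hM)
  set m := (cellSearch (cellFormula F h) (cellThreshold ε) 0 N).value with hm
  have hmM : m ≤ M := h3 M hM
  have hval : (cellEstimate F (cellThreshold ε) h).value = 2 ^ m * cellCard F m h := by
    rw [cellEstimate, OracleProg.value_bind, OracleProg.value_bind, value_boundedCount, ← hm,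
      min_eq_left h2.le]
    rfl
  have hpow : (0 : ℝ) < 2 ^ m := by positivity
  have hmean : (F.witnesses.card : ℝ) = 2 ^ m * cellMean F m := by
    rw [cellMean]
    field_simp
  have hmean0 : 0 ≤ cellMean F m := by
    rw [cellMean]
    positivity
  obtain ⟨d1, d2⟩ := abs_lt_of_sq_lt_sq' (hdev m hmM) (by positivity)
  have hfrac : cellMean F m / (1 + ε) = cellMean F m - cellMean F m * (ε / (1 + ε)) := by
    field_simp
    ring
  -- The deviation `ε / (1 + ε)` is exactly what the lower bound tolerates; the upper bound would
  -- tolerate `ε`.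
  have hle : cellMean F m * (ε / (1 + ε)) ≤ cellMean F m * ε :=
    mul_le_mul_of_nonneg_left (div_le_self hε.le (by linarith)) hmean0
  rw [GoodSeed, hval, hmean]
  push_cast
  constructor
  · rw [mul_div_assoc]
    exact mul_le_mul_of_nonneg_left (by linarith) hpow.le
  · rw [mul_left_comm]
    exact mul_le_mul_of_nonneg_left (by linarith) hpow.le

open Classical in
/-- One repetition fails with probability at most `1 / 16`. -/
theorem card_not_goodSeed_le {N : ℕ} (F : BForm (Fin N)) {ε : ℝ} (hε : 0 < ε)
    (hF : cellThreshold ε ≤ F.witnesses.card) :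
    ((Finset.univ.filter fun h : HashSeed N => ¬ GoodSeed F ε h).card : ℝ)
      ≤ Fintype.card (HashSeed N) * (1 / 16) := by
  set K : ℝ := (cellThreshold ε : ℝ) with hKdef
  set A : ℝ := (1 + 1 / ε) ^ 2 with hAdef
  have hA : 1 ≤ A := one_le_pow₀ (le_add_of_nonneg_right (by positivity))
  have hK : 128 * A + 1 ≤ K := le_cellThreshold ε
  have hFK : K ≤ F.witnesses.card := Nat.cast_le.2 hF
  obtain ⟨M, hMN, hM1, hM2⟩ := exists_cellMean_mem F (by linarith : (2 : ℝ) ≤ K) hFK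
  have hμ : ∀ m, 0 < cellMean F m := fun m => by
    have : (0 : ℝ) < F.witnesses.card := by linarith
    rw [cellMean]
    positivity
  let D : ℕ → Finset (HashSeed N) := fun m => Finset.univ.filter fun h =>
    (cellMean F m * (ε / (1 + ε))) ^ 2 ≤ ((cellCard F m h : ℝ) - cellMean F m) ^ 2
  let E : Finset (HashSeed N) := Finset.univ.filter fun h => cellThreshold ε ≤ cellCard F M h
  have hsub : (Finset.univ.filter fun h : HashSeed N => ¬ GoodSeed F ε h)
      ⊆ (Finset.range (M + 1)).biUnion D ∪ E := by
    intro h hh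
    by_contra hcon
    simp only [Finset.mem_union, Finset.mem_biUnion, Finset.mem_range, D, E, Finset.mem_filter,
      Finset.mem_univ, true_and, not_or, not_exists, not_and, not_le] at hcon
    exact (Finset.mem_filter.1 hh).2
      (goodSeed_of_forall F hε h hF hMN hcon.2 fun m hm => hcon.1 m (by omega))
  -- Chebyshev gives `A / μ_m`, which doubles with each level, so the sum over levels is at most
  -- twice its last term.
  have hD : ∀ m ∈ Finset.range (M + 1),
      ((D m).card : ℝ) ≤ Fintype.card (HashSeed N) * (A / F.witnesses.card * 2 ^ m) := by
    intro m hm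
    have hm' : m ≤ N := by
      have := Finset.mem_range.1 hm
      omega
    have hμm := hμ m
    refine (card_deviation_le F hm' (a := cellMean F m * (ε / (1 + ε))) (by positivity) (D m)
      fun h hh => (Finset.mem_filter.1 hh).2).trans (le_of_eq ?_)
    have hw : (0 : ℝ) < F.witnesses.card := by linarith
    rw [hAdef, cellMean]
    field_simp
    ring
  -- A large cell at level `M` exceeds its mean by at least `K - μ_M`, which is positive as `μ_M ≤
  -- 0.6 * K`.
  have hE : (E.card : ℝ) ≤ Fintype.card (HashSeed N) * (cellMean F M / (K - cellMean F M) ^ 2) := by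
    refine card_deviation_le F hMN (by linarith) E fun h hh => ?_
    have : K ≤ cellCard F M h := Nat.cast_le.2 (Finset.mem_filter.1 hh).2
    exact pow_le_pow_left₀ (by linarith) (by linarith) 2
  have hgeom : ∑ m ∈ Finset.range (M + 1), (2 : ℝ) ^ m ≤ 2 * 2 ^ M := by
    rw [geom_sum_eq (by norm_num), pow_succ]
    linarith
  calc ((Finset.univ.filter fun h : HashSeed N => ¬ GoodSeed F ε h).card : ℝ)
      ≤ (((Finset.range (M + 1)).biUnion D ∪ E).card : ℝ) := by
        exact_mod_cast Finset.card_le_card hsub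
    _ ≤ ∑ m ∈ Finset.range (M + 1), ((D m).card : ℝ) + E.card := by
        exact_mod_cast (Finset.card_union_le _ _).trans
          (Nat.add_le_add_right Finset.card_biUnion_le _)
    _ ≤ ∑ m ∈ Finset.range (M + 1),
          Fintype.card (HashSeed N) * (A / F.witnesses.card * 2 ^ m)
        + Fintype.card (HashSeed N) * (cellMean F M / (K - cellMean F M) ^ 2) :=
        add_le_add (Finset.sum_le_sum hD) hE
    _ = Fintype.card (HashSeed N) * (A / F.witnesses.card * ∑ m ∈ Finset.range (M + 1), 2 ^ m
        + cellMean F M / (K - cellMean F M) ^ 2) := by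
        rw [← Finset.mul_sum, ← Finset.mul_sum, mul_add]
    _ ≤ Fintype.card (HashSeed N) * (2 * A / cellMean F M
        + cellMean F M / (K - cellMean F M) ^ 2) := by
        refine mul_le_mul_of_nonneg_left (add_le_add_left ?_ _) (Nat.cast_nonneg _)
        have hw : (0 : ℝ) < F.witnesses.card := by linarith
        calc A / F.witnesses.card * ∑ m ∈ Finset.range (M + 1), (2 : ℝ) ^ m
            ≤ A / F.witnesses.card * (2 * 2 ^ M) :=
              mul_le_mul_of_nonneg_left hgeom (by positivity)
          _ = 2 * A / cellMean F M := by
              rw [cellMean]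
              field_simp
    _ ≤ _ := mul_le_mul_of_nonneg_left (threshold_tail_le hA hK hM1 hM2) (Nat.cast_nonneg _)

/-! ### The median -/

/-- In the sorted list, both the part up to the middle and the part from the middle on, each
including it, have more entries than there are bad ones. So the median lies between two good values,
and `P` is order-convex. -/
theorem listMedian_mem_of_two_mul_countP_lt (l : List ℕ) (P : ℕ → Bool)
    (hP : ∀ a b c, a ≤ b → b ≤ c → P a = true → P c = true → P b = true)
    (hl : 2 * l.countP (fun x => !P x) < l.length) : P (listMedian l) = true := by
  set L := l.insertionSort (· ≤ ·) with hL
  have hperm : L.Perm l := List.perm_insertionSort _ l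
  have hlen : L.length = l.length := hperm.length_eq
  have hcount : L.countP (fun x => !P x) = l.countP fun x => !P x := hperm.countP_eq _
  have hsort : L.Pairwise (· ≤ ·) := List.pairwise_insertionSort _ l
  have hk : l.length / 2 < L.length := by omega
  have hmed : listMedian l = L[l.length / 2] := by
    rw [listMedian, ← hL, List.getD_eq_getElem _ _ hk]
  have hmono : ∀ (i j : ℕ) (hi : i < L.length) (hj : j < L.length), i ≤ j → L[i] ≤ L[j] := by
    intro i j hi hj hij
    rcases hij.eq_or_lt with rfl | h
    · exact le_rfl
    · exact List.pairwise_iff_getElem.1 hsort i j hi hj h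
  rw [hmed]
  by_contra hbad
  have hbelow : ∃ a ∈ L.take (l.length / 2 + 1), P a = true := by
    by_contra hcon
    push Not at hcon
    have h1 : (L.take (l.length / 2 + 1)).countP (fun x => !P x)
        = (L.take (l.length / 2 + 1)).length :=
      List.countP_eq_length.2 fun a ha => by simpa using hcon a ha
    have h2 := (List.take_sublist (l.length / 2 + 1) L).countP_le (p := fun x => !P x)
    rw [List.length_take] at h1
    omega
  have habove : ∃ a ∈ L.drop (l.length / 2), P a = true := by
    by_contra hcon
    push Not at hcon
    have h1 : (L.drop (l.length / 2)).countP (fun x => !P x)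
        = (L.drop (l.length / 2)).length :=
      List.countP_eq_length.2 fun a ha => by simpa using hcon a ha
    have h2 := (List.drop_sublist (l.length / 2) L).countP_le (p := fun x => !P x)
    rw [List.length_drop] at h1
    omega
  obtain ⟨a, ha, hPa⟩ := hbelow
  obtain ⟨c, hc, hPc⟩ := habove
  obtain ⟨i, hi, rfl⟩ := List.mem_take_iff_getElem.1 ha
  obtain ⟨j, hj, rfl⟩ := List.mem_drop_iff_getElem.1 hc
  exact hbad (hP _ _ _ (hmono _ _ _ _ (by omega)) (hmono _ _ _ _ (by omega)) hPa hPc)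

/-- If an event has probability at most `1 / 16`, then in `t` independent repetitions it occurs in
at least half of them with probability at most `2⁻ᵗ`. -/
theorem card_two_mul_ge_le {H : Type} [Fintype H] (p : H → Prop) [DecidablePred p]
    (hp : ((Finset.univ.filter p).card : ℝ) ≤ Fintype.card H * (1 / 16)) (t : ℕ) :
    ((Finset.univ.filter fun s : Fin t → H =>
      t ≤ 2 * (Finset.univ.filter fun i => p (s i)).card).card : ℝ)
      ≤ (1 / 2) ^ t * Fintype.card (Fin t → H) := by
  set S := Finset.univ.filter fun s : Fin t → H =>
      t ≤ 2 * (Finset.univ.filter fun i => p (s i)).card with hS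
  -- Markov's inequality for `16 ^ (number of failures)`: the mean of `f` is at most `1 + 15/16 ≤
  -- 2`, while at least `t / 2` failures force the product to be at least `4 ^ t`.
  let f : H → ℝ := fun h => if p h then 16 else 1
  have hf : ∑ h, f h ≤ 2 * Fintype.card H := by
    have h1 : ∀ h, f h = 1 + 15 * (if p h then 1 else 0) := by
      intro h
      simp only [f]
      split_ifs <;> norm_num
    simp only [h1, Finset.sum_add_distrib, ← Finset.mul_sum, Finset.sum_boole]
    simp only [Finset.sum_const, Finset.card_univ, nsmul_eq_mul, mul_one]
    have : (0 : ℝ) ≤ Fintype.card H := Nat.cast_nonneg _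
    linarith
  have hf0 : ∀ h, 0 ≤ f h := fun h => by simp only [f]; split_ifs <;> norm_num
  have hprod : ∀ s ∈ S, (4 : ℝ) ^ t ≤ ∏ i, f (s i) := by
    intro s hs
    have h1 : ∏ i, f (s i) = 16 ^ (Finset.univ.filter fun i => p (s i)).card := by
      simp [f, Finset.prod_ite]
    rw [h1, show (16 : ℝ) = 4 ^ 2 by norm_num, ← pow_mul]
    exact pow_le_pow_right₀ (by norm_num) (Finset.mem_filter.1 hs).2
  have hmain : (S.card : ℝ) * 4 ^ t ≤ (2 * Fintype.card H) ^ t := by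
    calc (S.card : ℝ) * 4 ^ t = ∑ _s ∈ S, (4 : ℝ) ^ t := by rw [Finset.sum_const, nsmul_eq_mul]
      _ ≤ ∑ s ∈ S, ∏ i, f (s i) := Finset.sum_le_sum hprod
      _ ≤ ∑ s : Fin t → H, ∏ i, f (s i) :=
        Finset.sum_le_sum_of_subset_of_nonneg (Finset.subset_univ _)
          fun s _ _ => Finset.prod_nonneg fun i _ => hf0 _
      _ = (∑ h, f h) ^ t := (Fintype.sum_pow f t).symm
      _ ≤ _ := pow_le_pow_left₀ (Finset.sum_nonneg fun h _ => hf0 h) hf t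
  have h4 : (4 : ℝ) ^ t = 2 ^ t * 2 ^ t := by rw [← mul_pow]; norm_num
  rw [mul_pow, h4, mul_comm, mul_assoc] at hmain
  have := le_of_mul_le_mul_left hmain (by positivity)
  rw [Fintype.card_fun, Fintype.card_fin]
  push_cast
  rw [one_div, inv_pow, inv_mul_eq_div, le_div_iff₀ (by positivity), mul_comm]
  exact this

/-! ### The hashing-based counter -/

theorem half_pow_repetitions_le {δ : ℝ} (hδ : 0 < δ) : (1 / 2 : ℝ) ^ repetitions δ ≤ δ := by
  have h1 : Real.logb 2 (1 / δ) ≤ (repetitions δ : ℝ) := by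
    rw [repetitions]
    push_cast
    exact (Nat.le_ceil _).trans (le_max_right _ _)
  rw [Real.logb_le_iff_le_rpow (by norm_num) (by positivity), Real.rpow_natCast] at h1
  rw [one_div, inv_pow, inv_le_comm₀ (by positivity) hδ, ← one_div]
  exact h1

theorem value_hashCounter_of_lt {N : ℕ} (F : BForm (Fin N)) {ε δ : ℝ}
    (hF : F.witnesses.card < cellThreshold ε) (s : (hashCounter N F ε δ).Seed) :
    ((hashCounter N F ε δ).prog s).value = F.witnesses.card := by
  simp only [hashCounter, OracleProg.value_bind, value_boundedCount, min_eq_left hF.le, if_pos hF,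
    OracleProg.value]

theorem value_hashCounter_of_le {N : ℕ} (F : BForm (Fin N)) {ε δ : ℝ}
    (hF : cellThreshold ε ≤ F.witnesses.card) (s : Fin (repetitions δ) → HashSeed N) :
    ((hashCounter N F ε δ).prog s).value = listMedian
      (List.ofFn fun i => (cellEstimate F (cellThreshold ε) (s i)).value) := by
  simp only [hashCounter, OracleProg.value_bind, value_boundedCount, min_eq_right hF,
    lt_irrefl, if_false, OracleProg.value, OracleProg.value_runAll, List.map_ofFn,
    Function.comp_def]

theorem countP_ofFn {α : Type} (p : α → Bool) {t : ℕ} (f : Fin t → α) :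
    (List.ofFn f).countP p = (Finset.univ.filter fun i => p (f i) = true).card := by
  rw [List.ofFn_eq_map, List.countP_map, List.countP_eq_length_filter,
    ← List.toFinset_card_of_nodup ((List.nodup_finRange t).filter _), List.toFinset_filter,
    List.toFinset_finRange]
  rfl

theorem ofReal_one_sub_le_toOuterMeasure_uniform {Ω : Type} [Fintype Ω] [Nonempty Ω] {δ : ℝ}
    (bad : Finset Ω) (S : Set Ω) (hS : ∀ ω, ω ∉ bad → ω ∈ S)
    (hbad : (bad.card : ℝ) ≤ δ * Fintype.card Ω) :
    ENNReal.ofReal (1 - δ) ≤ (PMF.uniformOfFintype Ω).toOuterMeasure S := by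
  classical
  have hcard : (0 : ℝ) < Fintype.card Ω := by exact_mod_cast Fintype.card_pos
  have hsub : Finset.univ.filter (· ∉ bad) ⊆ Finset.univ.filter (· ∈ S) :=
    Finset.monotone_filter_right _ fun ω _ h => hS ω h
  have h1 := Finset.card_le_card hsub
  have h2 := Finset.card_filter_add_card_filter_not (s := (Finset.univ : Finset Ω)) (· ∈ bad)
  have h3 : (Finset.univ : Finset Ω).filter (· ∈ bad) = bad := by simp
  rw [h3, Finset.card_univ] at h2
  rw [PMF.toOuterMeasure_uniformOfFintype_apply, ← ENNReal.ofReal_natCast,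
    ← ENNReal.ofReal_natCast, ← ENNReal.ofReal_div_of_pos hcard]
  refine ENNReal.ofReal_le_ofReal ?_
  rw [le_div_iff₀ hcard, Fintype.card_subtype]
  have h4 : (Fintype.card Ω : ℝ) ≤ bad.card + (Finset.univ.filter (· ∈ S)).card := by
    exact_mod_cast h2.symm.le.trans (Nat.add_le_add_left h1 _)
  linarith

theorem isApproxModelCounter_hashCounter : IsApproxModelCounter hashCounter := by
  classical
  intro N F ε δ hε hδ hδ1
  unfold IsEstimate
  rcases lt_or_ge F.witnesses.card (cellThreshold ε) with hF | hF
  · have huniv : {s | (F.witnesses.card : ℝ) / (1 + ε) ≤ ((hashCounter N F ε δ).prog s).value ∧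
        ((hashCounter N F ε δ).prog s).value ≤ (1 + ε) * F.witnesses.card} = Set.univ := by
      refine Set.eq_univ_of_forall fun s => ?_
      rw [Set.mem_ofPred_eq, value_hashCounter_of_lt F hF]
      have : (0 : ℝ) ≤ F.witnesses.card := Nat.cast_nonneg _
      exact ⟨div_le_self this (by linarith), le_mul_of_one_le_left this (by linarith)⟩
    rw [huniv, (PMF.toOuterMeasure_apply_eq_one_iff _ _).2 (Set.subset_univ _),
      ENNReal.ofReal_le_one]
    linarith
  · refine ofReal_one_sub_le_toOuterMeasure_uniform
      (Ω := Fin (repetitions δ) → HashSeed N)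
      (Finset.univ.filter fun s =>
        repetitions δ ≤ 2 * (Finset.univ.filter fun i => ¬ GoodSeed F ε (s i)).card) _ ?_ ?_
    · intro s hs
      have hs' : 2 * (Finset.univ.filter fun i => ¬ GoodSeed F ε (s i)).card < repetitions δ := by
        simpa using hs
      change _ / _ ≤ ((hashCounter N F ε δ).prog s).value ∧
        ((hashCounter N F ε δ).prog s).value ≤ _
      rw [value_hashCounter_of_le F hF s]
      have := listMedian_mem_of_two_mul_countP_lt
        (List.ofFn fun i => (cellEstimate F (cellThreshold ε) (s i)).value)
        (fun v => decide ((F.witnesses.card : ℝ) / (1 + ε) ≤ v ∧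
          (v : ℝ) ≤ (1 + ε) * F.witnesses.card))
        (by
          intro a b c hab hbc ha hc
          rw [decide_eq_true_iff] at ha hc ⊢
          exact ⟨ha.1.trans (by exact_mod_cast hab), le_trans (by exact_mod_cast hbc) hc.2⟩)
        (by
          rw [countP_ofFn, List.length_ofFn]
          simp only [Bool.not_eq_true', decide_eq_false_iff_not]
          convert hs'
          exact Iff.rfl)
      exact of_decide_eq_true this
    · refine (card_two_mul_ge_le (fun h : HashSeed N => ¬ GoodSeed F ε h) ?_ _).trans
        (mul_le_mul_of_nonneg_right (half_pow_repetitions_le hδ) (Nat.cast_nonneg _))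
      exact card_not_goodSeed_le F hε hF

/-! ### The number of oracle calls -/

theorem calls_cellEstimate_le {N : ℕ} (F : BForm (Fin N)) (K : ℕ) (h : HashSeed N) :
    (cellEstimate F K h).calls ≤ (Nat.clog 2 N + 1) * K := by
  rw [cellEstimate, OracleProg.calls_bind, OracleProg.calls_bind, Nat.succ_mul]
  refine Nat.add_le_add (calls_cellSearch_le _ K _ _ _ (Nat.le_pow_clog (by norm_num) _)) ?_
  exact calls_boundedCount_le _ K

theorem calls_hashCounter_le {N : ℕ} (F : BForm (Fin N)) (ε δ : ℝ)
    (s : (hashCounter N F ε δ).Seed) :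
    ((hashCounter N F ε δ).prog s).calls
      ≤ cellThreshold ε + repetitions δ * ((Nat.clog 2 N + 1) * cellThreshold ε) := by
  simp only [hashCounter, OracleProg.calls_bind]
  refine Nat.add_le_add (calls_boundedCount_le _ _) ?_
  split_ifs
  · simp [OracleProg.calls]
  · rw [OracleProg.calls_bind, OracleProg.calls_runAll, List.map_ofFn, List.sum_ofFn]
    simp only [OracleProg.calls, add_zero, Function.comp_def]
    refine (Finset.sum_le_sum fun i _ => calls_cellEstimate_le F (cellThreshold ε) (s i)).trans ?_
    simp

/-- `514 = 128 * 4 + 2`: the square, multiplied by `ε²` if `ε ≤ 1`, is at most 4, and 2 covers the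
rounding and the added 1. -/
theorem cellThreshold_le {ε : ℝ} (hε : 0 < ε) :
    (cellThreshold ε : ℝ) ≤ 514 / min 1 (ε ^ 2) := by
  have h1 : (cellThreshold ε : ℝ) ≤ 128 * (1 + 1 / ε) ^ 2 + 2 := by
    have := Nat.ceil_lt_add_one (show (0 : ℝ) ≤ 128 * (1 + 1 / ε) ^ 2 by positivity)
    rw [cellThreshold]
    push_cast
    linarith
  refine h1.trans ?_
  rcases le_total 1 ε with h | h
  · rw [min_eq_left (one_le_pow₀ h), div_one]
    have h2 : 1 / ε ≤ 1 := by rw [div_le_one hε]; exact h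
    have h3 : 0 < 1 / ε := by positivity
    nlinarith
  · rw [min_eq_right (pow_le_one₀ hε.le h), le_div_iff₀ (by positivity)]
    have h2 : (1 + 1 / ε) ^ 2 * ε ^ 2 = (ε + 1) ^ 2 := by field_simp
    nlinarith

theorem repetitions_le {δ : ℝ} (hδ : 0 < δ) (hδ1 : δ ≤ 1) :
    (repetitions δ : ℝ) ≤ 2 * max 1 (Real.logb 2 (1 / δ)) := by
  have h0 : 0 ≤ Real.logb 2 (1 / δ) :=
    Real.logb_nonneg (by norm_num) (by rw [le_div_iff₀ hδ]; linarith)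
  have h1 := Nat.ceil_lt_add_one h0
  have h2 := le_max_left 1 (Real.logb 2 (1 / δ))
  have h3 := le_max_right 1 (Real.logb 2 (1 / δ))
  rw [repetitions]
  push_cast
  refine max_le ?_ ?_ <;> linarith

theorem clog_two_le (N : ℕ) : (Nat.clog 2 N : ℝ) ≤ 2 * max 1 (Real.logb 2 N) := by
  have h2 := le_max_left 1 (Real.logb 2 N)
  have h3 := le_max_right 1 (Real.logb 2 N)
  have h0 : 0 ≤ Real.logb 2 N := by
    rcases Nat.eq_zero_or_pos N with rfl | h
    · simp
    · exact Real.logb_nonneg (by norm_num) (by exact_mod_cast h)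
  rw [← Real.natCeil_logb_natCast 2 N]
  have := Nat.ceil_lt_add_one h0
  push_cast at this ⊢
  linarith

theorem calls_algA_hashCounter_le {n : ℕ} (Q : DIQuery n) {ε δ : ℝ} (hε : 0 < ε) (hδ : 0 < δ)
    (hδ1 : δ ≤ 1) (s : (algA hashCounter Q ε δ).Seed) :
    (((algA hashCounter Q ε δ).prog s).calls : ℝ) ≤
      3598 * (max 1 (Real.logb 2 ((n : ℝ) + ∑ i, (Q.bits i : ℝ))) *
        max 1 (Real.logb 2 (1 / δ)) / min 1 (ε ^ 2)) := by
  have hcalls : ((algA hashCounter Q ε δ).prog s).calls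
      = ((hashCounter Q.numVars Q.hatF ε δ).prog s).calls := by
    simp only [algA, OracleProg.calls_bind, OracleProg.calls, add_zero]
  have hN : (n : ℝ) + ∑ i, (Q.bits i : ℝ) = (Q.numVars : ℝ) := by
    rw [DIQuery.numVars]
    push_cast
    rfl
  have hle : (((hashCounter Q.numVars Q.hatF ε δ).prog s).calls : ℝ)
      ≤ cellThreshold ε
        + repetitions δ * ((Nat.clog 2 Q.numVars + 1) * cellThreshold ε) := by
    exact_mod_cast calls_hashCounter_le Q.hatF ε δ s
  rw [hcalls, hN]
  refine hle.trans ?_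
  have hK := cellThreshold_le hε
  have ht := repetitions_le hδ hδ1
  have hc := clog_two_le Q.numVars
  set a := max 1 (Real.logb 2 (Q.numVars : ℝ))
  set b := max 1 (Real.logb 2 (1 / δ))
  have ha : 1 ≤ a := le_max_left _ _
  have hb : 1 ≤ b := le_max_left _ _
  have hd : 0 < min 1 (ε ^ 2) := lt_min one_pos (by positivity)
  have hab : 1 ≤ a * b := one_le_mul_of_one_le_of_one_le ha hb
  -- Adding the initial exact count gives `1 + 6 * (a * b) ≤ 7 * (a * b)`, and `3598 = 7 * 514`.
  have hprod : (repetitions δ : ℝ) * (Nat.clog 2 Q.numVars + 1) ≤ (2 * b) * (3 * a) :=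
    mul_le_mul ht (by linarith) (by positivity) (by linarith)
  calc (cellThreshold ε : ℝ) + repetitions δ * ((Nat.clog 2 Q.numVars + 1) * cellThreshold ε)
      = (1 + repetitions δ * (Nat.clog 2 Q.numVars + 1)) * cellThreshold ε := by ring
    _ ≤ (7 * (a * b)) * (514 / min 1 (ε ^ 2)) :=
      mul_le_mul (by linarith) hK (Nat.cast_nonneg _) (by positivity)
    _ = _ := by ring

theorem theorem1 :
    -- with every approximate model counter, the algorithm returns an `(ε, δ)` estimate of `W(F)`
    (∀ B : ModelCounter, IsApproxModelCounter B →
      ∀ (n : ℕ) (Q : DIQuery n) (ε δ : ℝ), 0 < ε → 0 < δ → δ ≤ 1 →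
        IsEstimate (algA B Q ε δ) ε δ Q.weight) ∧
    -- the hashing-based counter is one, and with it every run makes few calls to the NP oracle
    IsApproxModelCounter hashCounter ∧
    ∃ C : ℝ, ∀ (n : ℕ) (Q : DIQuery n) (ε δ : ℝ), 0 < ε → 0 < δ → δ ≤ 1 →
      ∀ s : (algA hashCounter Q ε δ).Seed,
        (((algA hashCounter Q ε δ).prog s).calls : ℝ) ≤
          C * (max 1 (Real.logb 2 ((n : ℝ) + ∑ i, (Q.bits i : ℝ))) *
            max 1 (Real.logb 2 (1 / δ)) / min 1 (ε ^ 2)) := by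
  exact ⟨fun B hB n Q ε δ hε hδ hδ1 => isEstimate_algA hB Q hε hδ hδ1,
    isApproxModelCounter_hashCounter,
    3598, fun n Q ε δ hε hδ hδ1 s => calls_algA_hashCounter_le Q hε hδ hδ1 s⟩
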